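/- **Notation.** Let $n\ge 1$, $d\ge 1$, $\ell\ge 0$ be integers, $\bar x=(x_1,\dots,x_{n-1})$, $e$ the all-ones vector, and $\overline{\mathbb N}^n_d=\{\alpha\in\mathbb N^n:|\alpha|=d\}$, $\mathbb N^{n-1}_d=\{\alpha\in\mathbb N^{n-1}:|\alpha|\le d\}$. Write $\langle p,z\rangle=\sum_\alpha p_\alpha z_\alpha$ for a polynomial $p$ and a vector $z$ labelled by exponents. Let $\overline\Delta=\{\bar x\in\mathbb R^{n-1}:\bar x\ge 0,\ 1-e^T\bar x\ge 0\}$, let $\mathscr P_d(\overline\Delta)$ be the cone of polynomials in $\mathbb R[\bar x]$ of degree at most $d$ that are nonnegative on $\overline\Delta$, and let $\mathscr R_d(\overline\Delta)\subseteq\mathbb R^{\mathbb N^{n-1}_d}$ be the cone of all sums $\sum_{i=1}^r\lambda_i[v_i]_d$ with $r\in\mathbb N$, $\lambda_i\ge0$, $v_i\in\overline\Delta$, where $[v]_d=(v^\alpha)_{|\alpha|\le d}$. For $z\in\mathbb R^{\mathbb N^{n-1}_{2k}}$ and a polynomial $q$ of degree at most $2k$, the localizing matrix $L^{(k)}_q[z]$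 has rows and columns labelled by the $\alpha\in\mathbb N^{n-1}$ with $\deg q+2|\alpha|\le 2k$ and entries $\langle q\,\bar x^{\alpha+\beta},z\rangle$; $M_k[z]=L_1^{(k)}[z]$. Write $z|_d=(z_\alpha)_{|\alpha|\le d}$. **Data.** Let $\mathcal A_0,\dots,\mathcal A_\ell$ be symmetric tensors of order $d$ over $\mathbb R^n$, $c\in\mathbb R^\ell$, $K$ a Cartesian product of finitely many linear (nonnegative orthant), second-order and positive semidefinite cones, $K^*$ its dual cone, and $f_0,\dots,f_\ell$ vectors in the space of $K$. Let $a_i=\phi(\mathcal A_i)\in\mathbb R^{\overline{\mathbb N}^n_d}$ be given by $(a_i)_\alpha=(\mathcal A_i)_{i_1\dots i_d}$ whenever $x^\alpha=x_{i_1}\cdots x_{i_d}$, and let $\hat a_i=\varpi^{-T}(a_i)\in\mathbb R^{\mathbb N^{n-1}_d}$ be given by $(\hat a_i)_\alpha=\langle \bar x^\alpha(e^Tx)^{d-|\alpha|},a_i\rangle$ for $|\alpha|\le d$. Consider the dehomogenized CP conic problem $$(P)\quad \min_{w\in\mathbb R^\ell}\ c^Tw\quad\text{s.t.}\quad \hat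 a_0+\sum_{i=1}^\ell w_i\hat a_i\in\mathscr R_d(\overline\Delta),\quad f_0+\sum_{i=1}^\ell w_if_i\in K,$$ its dual $$(D)\quad \max_{\hat p,\eta}\ -\langle\hat a_0,\hat p\rangle-f_0^T\eta\quad\text{s.t.}\quad \langle\hat a_i,\hat p\rangle+f_i^T\eta=c_i\ (1\le i\le\ell),\quad \hat p\in\mathscr P_d(\overline\Delta),\ \eta\in K^*,$$ and, for $k\ge d_0:=\lceil d/2\rceil$, the $k$th order moment relaxation of $(P)$ $$(P_k)\quad \min_{w,z}\ c^Tw\quad\text{s.t.}\quad \hat a_0+\sum_{i=1}^\ell w_i\hat a_i=z|_d,\quad f_0+\sum_{i=1}^\ell w_if_i\in K,\quad z\in\mathbb R^{\mathbb N^{n-1}_{2k}},$$ $$M_k[z]\succeq0,\quad L^{(k)}_{x_i}[z]\succeq0\ (1\le i\le n-1),\quad L^{(k)}_{1-e^T\bar x}[z]\succeq0,\quad L^{(k)}_{1-\|\bar x\|^2}[z]\succeq0 .$$ **Theorem (asymptotic convergence).** Assume that the vectors $\hat a_0,\dots,\hat a_\ell$ are linearly independent, that $(P)$ is feasible, and that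 $(D)$ has a feasible pair $(\hat p,\eta)$ with $\hat p>0$ on $\overline\Delta$. For every $k\ge d_0$ let $(w^{(k)},z^{(k)})$ be a minimizer of $(P_k)$. Then the sequence $\{w^{(k)}\}_{k=d_0}^\infty$ is bounded, and each of its accumulation points is a minimizer of $(P)$. -/

import Mathlib

open scoped Matrix

noncomputable section

namespace CPConic

/-! ### Exponents, truncated multi-sequences and pairings -/

/-- The power set of exponents `α ∈ ℕ^m` with `|α| ≤ d`. -/
abbrev Expo (m d : ℕ) : Type := {α : Fin m →₀ ℕ // α.degree ≤ d}

/-- The power set of exponents `α ∈ ℕ^n` with `|α| = d`. -/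
abbrev HomExpo (n d : ℕ) : Type := {α : Fin n →₀ ℕ // α.degree = d}

instance instFintypeExpo (m d : ℕ) : Fintype (Expo m d) :=
  (Finsupp.finite_of_degree_le d).fintype

instance instFintypeHomExpo (n d : ℕ) : Fintype (HomExpo n d) :=
  (Finsupp.finite_of_degree_eq d).fintype

/-- Truncated multi-sequences: real vectors labelled by the exponents of degree at most `d`. -/
abbrev Tms (m d : ℕ) : Type := Expo m d → ℝ

/-- Homogeneous truncated multi-sequences: real vectors labelled by the exponents of degree `d`. -/
abbrev HTms (n d : ℕ) : Type := HomExpo n d → ℝ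

/-- `⟨p, z⟩ = ∑_{|α| ≤ d} p_α z_α`, for polynomials `p` of degree at most `d`. -/
def pair {m d : ℕ} (p : MvPolynomial (Fin m) ℝ) (z : Tms m d) : ℝ :=
  ∑ α : Expo m d, p.coeff α.1 * z α

/-- `⟨p, y⟩ = ∑_{|α| = d} p_α y_α`, for forms `p` of degree `d`. -/
def homPair {n d : ℕ} (p : MvPolynomial (Fin n) ℝ) (y : HTms n d) : ℝ :=
  ∑ α : HomExpo n d, p.coeff α.1 * y α

/-- The vector `[v]_d` of all monomials of degree at most `d` at the point `v`. -/
def monoVec {m : ℕ} (d : ℕ) (v : Fin m → ℝ) : Tms m d :=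
  fun α => ∏ i, v i ^ α.1 i

/-- The truncation `z|_d` of a truncated multi-sequence. -/
def trunc {m d e : ℕ} (h : d ≤ e) (z : Tms m e) : Tms m d :=
  fun α => z ⟨α.1, α.2.trans h⟩

/-! ### Symmetric tensors and the map to homogeneous truncated multi-sequences -/

/-- The space of symmetric tensors of order `d` over `ℝ^n`. -/
def SymTensor (n d : ℕ) : Submodule ℝ ((Fin d → Fin n) → ℝ) where
  carrier := {T | ∀ (σ : Equiv.Perm (Fin d)) (i : Fin d → Fin n), T (i ∘ σ) = T i}
  add_mem' hS hT σ i := by simp only [Pi.add_apply]; rw [hS σ i, hT σ i]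
  zero_mem' _ _ := rfl
  smul_mem' c T hT σ i := by simp only [Pi.smul_apply]; rw [hT σ i]

/-- The exponent `α` with `x^α = x_{i_1} ⋯ x_{i_d}`. -/
def labelExpo {n d : ℕ} (i : Fin d → Fin n) : Fin n →₀ ℕ :=
  ∑ j, Finsupp.single (i j) 1

theorem exists_label {n : ℕ} : ∀ (d : ℕ) (α : Fin n →₀ ℕ), α.degree = d →
    ∃ i : Fin d → Fin n, labelExpo i = α := by
  intro d
  induction d with
  | zero =>
    intro α h
    refine ⟨Fin.elim0, ?_⟩
    rw [Finsupp.degree_eq_zero_iff] at h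
    simp [labelExpo, h]
  | succ d ih =>
    intro α h
    have hne : α ≠ 0 := by
      rintro rfl
      simp at h
    obtain ⟨v, hv⟩ := Finsupp.ne_iff.1 hne
    have hle : Finsupp.single v 1 ≤ α := by
      rw [Finsupp.single_le_iff]
      exact Nat.one_le_iff_ne_zero.2 hv
    have hadd : Finsupp.single v 1 + (α - Finsupp.single v 1) = α := add_tsub_cancel_of_le hle
    have hdeg : (α - Finsupp.single v 1).degree = d := by
      have := congrArg Finsupp.degree hadd
      rw [map_add, Finsupp.degree_single, h] at this
      omega
    obtain ⟨i, hi⟩ := ih _ hdeg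
    refine ⟨Fin.cons v i, ?_⟩
    rw [← hadd, ← hi]
    simp [labelExpo, Fin.sum_univ_succ]

/-- The map `φ` with `φ(A)_α = A_{i_1 … i_d}` whenever `x^α = x_{i_1} ⋯ x_{i_d}`. By symmetry of
`A` the choice of the label `(i_1, …, i_d)` does not matter; see `phi_labelExpo`. -/
def phi {n d : ℕ} (A : SymTensor n d) : HTms n d :=
  fun α => A.1 (exists_label d α.1 α.2).choose

theorem apply_eq_of_labelExpo_eq {n d : ℕ} (A : SymTensor n d) (i j : Fin d → Fin n)
    (h : labelExpo i = labelExpo j) : A.1 i = A.1 j := by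
  classical
  have hcard : ∀ v, Fintype.card {k // i k = v} = Fintype.card {k // j k = v} := by
    intro v
    have h' := DFunLike.congr_fun h v
    simpa [labelExpo, Finsupp.finsetSum_apply, Finsupp.single_apply, Fintype.card_subtype,
      Finset.sum_boole] using h'
  let e : ∀ v, {k // i k = v} ≃ {k // j k = v} := fun v => Fintype.equivOfCardEq (hcard v)
  let σ : Equiv.Perm (Fin d) := (Equiv.sigmaFiberEquiv i).symm.trans
    ((Equiv.sigmaCongrRight e).trans (Equiv.sigmaFiberEquiv j))
  have hσ : j ∘ σ = i := by
    funext k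
    exact (e (i k) ⟨k, rfl⟩).2
  rw [← hσ]
  exact A.2 σ j

theorem phi_labelExpo {n d : ℕ} (A : SymTensor n d) (i : Fin d → Fin n)
    (h : (labelExpo i).degree = d) : phi A ⟨labelExpo i, h⟩ = A.1 i :=
  apply_eq_of_labelExpo_eq A _ i (exists_label d (labelExpo i) h).choose_spec

/-! ### Dehomogenization. The number of variables is `n = m + 1`, so that `n - 1 = m`. -/

/-- The linear form `e^T x = x_1 + ⋯ + x_n`. -/
def sumX (n : ℕ) : MvPolynomial (Fin n) ℝ := ∑ i, MvPolynomial.X i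

/-- The dehomogenization map `ϖ(f) = f(x̄, 1 - e^T x̄)`. -/
def varpi (m : ℕ) : MvPolynomial (Fin (m + 1)) ℝ →ₐ[ℝ] MvPolynomial (Fin m) ℝ :=
  MvPolynomial.aeval (Fin.snoc (α := fun _ => MvPolynomial (Fin m) ℝ) MvPolynomial.X (1 - sumX m))

/-- `ϖ^{-1}(x̄^α) = x̄^α (e^T x)^{d - |α|}`, for `|α| ≤ d`. -/
def varpiInvMono {m d : ℕ} (α : Expo m d) : MvPolynomial (Fin (m + 1)) ℝ :=
  MvPolynomial.rename Fin.castSucc (MvPolynomial.monomial α.1 1) * sumX (m + 1) ^ (d - α.1.degree)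

theorem varpi_varpiInvMono {m d : ℕ} (α : Expo m d) :
    varpi m (varpiInvMono α) = MvPolynomial.monomial α.1 1 := by
  have h1 : varpi m (sumX (m + 1)) = 1 := by
    simp [varpi, sumX, Fin.sum_univ_castSucc]
  have h2 : varpi m (MvPolynomial.rename Fin.castSucc (MvPolynomial.monomial α.1 (1 : ℝ)))
      = MvPolynomial.monomial α.1 1 := by
    rw [varpi, MvPolynomial.aeval_rename]
    have : (Fin.snoc (α := fun _ => MvPolynomial (Fin m) ℝ) MvPolynomial.X (1 - sumX m))
        ∘ Fin.castSucc = (MvPolynomial.X : Fin m → MvPolynomial (Fin m) ℝ) := by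
      funext i
      simp
    rw [this, MvPolynomial.aeval_X_left, AlgHom.id_apply]
  rw [varpiInvMono, map_mul, map_pow, h1, h2, one_pow, mul_one]

theorem varpiInvMono_isHomogeneous {m d : ℕ} (α : Expo m d) :
    (varpiInvMono α).IsHomogeneous d := by
  have h1 : (MvPolynomial.rename Fin.castSucc (MvPolynomial.monomial α.1 (1 : ℝ)) :
      MvPolynomial (Fin (m + 1)) ℝ).IsHomogeneous α.1.degree :=
    (MvPolynomial.isHomogeneous_monomial 1 rfl).rename_isHomogeneous
  have h2 : (sumX (m + 1)).IsHomogeneous 1 :=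
    MvPolynomial.IsHomogeneous.sum _ _ _ fun i _ => MvPolynomial.isHomogeneous_X ℝ i
  have h3 := h1.mul (h2.pow (d - α.1.degree))
  have h4 : α.1.degree + 1 * (d - α.1.degree) = d := by
    have := α.2
    omega
  rwa [h4] at h3

/-- The inverse adjoint map `ϖ^{-T}`, given by
`ϖ^{-T}(y)_α = ⟨ϖ^{-1}(x̄^α), y⟩ = ⟨x̄^α (e^T x)^{d - |α|}, y⟩`. -/
def varpiInvAdj {m d : ℕ} (y : HTms (m + 1) d) : Tms m d :=
  fun α => homPair (varpiInvMono α) y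

/-! ### The simplicial set, its moment cone, and localizing matrices -/

/-- `Δ̄ = {x̄ ∈ ℝ^m : x̄ ≥ 0, 1 - e^T x̄ ≥ 0}`. -/
def simplexBar (m : ℕ) : Set (Fin m → ℝ) := {x | (∀ i, 0 ≤ x i) ∧ 0 ≤ 1 - ∑ i, x i}

/-- The cone of polynomials of degree at most `d` that are nonnegative on `Δ̄`. -/
def nonnegPoly (m d : ℕ) : Set (MvPolynomial (Fin m) ℝ) :=
  {p | p.totalDegree ≤ d ∧ ∀ x ∈ simplexBar m, 0 ≤ MvPolynomial.eval x p}

/-- The moment cone of all `∑ λ_i [v_i]_d` with `λ_i ≥ 0` and `v_i ∈ Δ̄`. -/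
def momentCone (m d : ℕ) : Set (Tms m d) :=
  {y | ∃ (r : ℕ) (lam : Fin r → ℝ) (v : Fin r → Fin m → ℝ),
    (∀ i, 0 ≤ lam i) ∧ (∀ i, v i ∈ simplexBar m) ∧ y = ∑ i, lam i • monoVec d (v i)}

/-- The `k`th order localizing matrix `L_q^{(k)}[z]`, whose rows and columns are labelled by the
monomials `x̄^α` with `deg q + 2|α| ≤ 2k`; it satisfies
`⟨q a², z⟩ = vec(a)^T L_q^{(k)}[z] vec(a)` for all polynomials `a` with `deg (q a²) ≤ 2k`. -/
def localizingMatrix {m : ℕ} (k : ℕ) (q : MvPolynomial (Fin m) ℝ) (z : Tms m (2 * k)) :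
    Matrix (Expo m ((2 * k - q.totalDegree) / 2)) (Expo m ((2 * k - q.totalDegree) / 2)) ℝ :=
  Matrix.of fun α β => pair (q * MvPolynomial.monomial (α.1 + β.1) 1) z

/-- The `k`th order moment matrix `M_k[z]`. -/
def momentMatrix {m : ℕ} (k : ℕ) (z : Tms m (2 * k)) :=
  localizingMatrix k 1 z

/-! ### The cone `K` -/

/-- The format of a Cartesian product of linear, second-order and semidefinite cones: the
nonnegative orthant of `ℝ^lin`, second-order cones in `ℝ × ℝ^(soc j)` for `j < numSoc`, and cones
of positive semidefinite matrices of size `sdp j` for `j < numSdp`. -/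
structure ConeFormat where
  lin : ℕ
  numSoc : ℕ
  soc : Fin numSoc → ℕ
  numSdp : ℕ
  sdp : Fin numSdp → ℕ

/-- The space of symmetric `t × t` matrices. -/
def SymMatrix (t : ℕ) : Submodule ℝ (Matrix (Fin t) (Fin t) ℝ) where
  carrier := {M | M.IsSymm}
  add_mem' hM hN := hM.add hN
  zero_mem' := Matrix.isSymm_zero
  smul_mem' c _ hM := hM.smul c

/-- The space in which the cone `K` lies. -/
abbrev ConeFormat.Space (F : ConeFormat) : Type :=
  (Fin F.lin → ℝ) × ((j : Fin F.numSoc) → ℝ × EuclideanSpace ℝ (Fin (F.soc j))) ×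
    ((j : Fin F.numSdp) → SymMatrix (F.sdp j))

/-- The product `K` of linear, second-order and semidefinite cones. -/
def ConeFormat.cone (F : ConeFormat) : Set F.Space :=
  {u | (∀ i, 0 ≤ u.1 i) ∧ (∀ j, ‖(u.2.1 j).2‖ ≤ (u.2.1 j).1) ∧
    ∀ j, (u.2.2 j : Matrix (Fin (F.sdp j)) (Fin (F.sdp j)) ℝ).PosSemidef}

/-- The dual cone `C^* = {ℓ ∈ V^* : ℓ(u) ≥ 0 for all u ∈ C}`. -/
def dualCone {V : Type*} [AddCommGroup V] [Module ℝ V] (C : Set V) : Set (Module.Dual ℝ V) :=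
  {η | ∀ u ∈ C, 0 ≤ η u}

/-! ### The conic problems -/

/-- The data of a linear conic optimization problem with CP tensors of order `d` over `ℝ^(m+1)`
in `ℓ` decision variables: the objective `c`, the symmetric tensors `A_0, …, A_ℓ`, the cone `K`,
and the vectors `f_0, …, f_ℓ` in the space of `K`. -/
structure Problem (m d ℓ : ℕ) where
  c : Fin ℓ → ℝ
  A : Fin (ℓ + 1) → SymTensor (m + 1) d
  K : ConeFormat
  f : Fin (ℓ + 1) → K.Space

namespace Problem

variable {m d ℓ : ℕ} (P : Problem m d ℓ)

/-- `â_i = ϖ^{-T}(φ(A_i))`. -/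
def aHat (i : Fin (ℓ + 1)) : Tms m d := varpiInvAdj (phi (P.A i))

/-- `â(w) = â_0 + ∑ w_i â_i`. -/
def aHatAt (w : Fin ℓ → ℝ) : Tms m d := P.aHat 0 + ∑ i : Fin ℓ, w i • P.aHat i.succ

/-- `f(w) = f_0 + ∑ w_i f_i`. -/
def fAt (w : Fin ℓ → ℝ) : P.K.Space := P.f 0 + ∑ i : Fin ℓ, w i • P.f i.succ

/-- Feasible points of the dehomogenized CP conic problem. -/
def feasible : Set (Fin ℓ → ℝ) := {w | P.aHatAt w ∈ momentCone m d ∧ P.fAt w ∈ P.K.cone}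

/-- Minimizers of the dehomogenized CP conic problem. -/
def IsMinimizer (w : Fin ℓ → ℝ) : Prop :=
  w ∈ P.feasible ∧ ∀ w' ∈ P.feasible, P.c ⬝ᵥ w ≤ P.c ⬝ᵥ w'

/-- Feasible pairs `(p̂, η)` of the dual of the dehomogenized CP conic problem. -/
def dualFeasible : Set (MvPolynomial (Fin m) ℝ × Module.Dual ℝ P.K.Space) :=
  {q | (∀ i : Fin ℓ, pair q.1 (P.aHat i.succ) + q.2 (P.f i.succ) = P.c i) ∧
    q.1 ∈ nonnegPoly m d ∧ q.2 ∈ dualCone P.K.cone}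

/-- Feasible pairs `(w, z)` of the `k`th order moment relaxation. -/
def relaxFeasible (k : ℕ) (h : d ≤ 2 * k) : Set ((Fin ℓ → ℝ) × Tms m (2 * k)) :=
  {q | P.aHatAt q.1 = trunc h q.2 ∧
    (∀ i : Fin m, (localizingMatrix k (MvPolynomial.X i) q.2).PosSemidef) ∧
    (localizingMatrix k (1 - sumX m) q.2).PosSemidef ∧
    (localizingMatrix k (1 - ∑ i : Fin m, MvPolynomial.X i ^ 2) q.2).PosSemidef ∧
    P.fAt q.1 ∈ P.K.cone ∧
    (momentMatrix k q.2).PosSemidef}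

/-- Minimizers `(w, z)` of the `k`th order moment relaxation. -/
def IsRelaxMinimizer (k : ℕ) (h : d ≤ 2 * k) (w : Fin ℓ → ℝ) (z : Tms m (2 * k)) : Prop :=
  (w, z) ∈ P.relaxFeasible k h ∧ ∀ q ∈ P.relaxFeasible k h, P.c ⬝ᵥ w ≤ P.c ⬝ᵥ q.1

end Problem

/-- The initial relaxation order `d_0 = ⌈d/2⌉`. -/
def initialOrder (d : ℕ) : ℕ := ⌈(d : ℚ) / 2⌉₊

theorem le_two_mul_of_initialOrder_le {d k : ℕ} (h : initialOrder d ≤ k) : d ≤ 2 * k := by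
  have h1 : (d : ℚ) / 2 ≤ k := Nat.ceil_le.1 h
  have h2 : (d : ℚ) ≤ ((2 * k : ℕ) : ℚ) := by push_cast; linarith
  exact_mod_cast h2

end CPConic

end

/-!
Let `(w_k, z_k)` minimize the `k`-th relaxation. Feasible points of the conic problem lift to every
relaxation, so the relaxation values never exceed the optimal value; what has to be controlled are
the limits of the moment sequences `z_k` as `k → ∞`.

The central fact is a truncated moment theorem for the simplex (`truncSeq_mem_momentCone`): if a
linear functional `L` on polynomials satisfies `L(p²) ≥ 0`, `L(x_i p²) ≥ 0` and
`L((1 - eᵀx̄) p²) ≥ 0` for all `p`, its moments of degree at most `d` lie in the moment cone. It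
replaces Putinar's Positivstellensatz and is proved on the side of the functionals. Elements `a` with
`L(a p²) ≥ 0` for all `p` act as positive operators in the Gelfand–Naimark–Segal representation, and
the product of two such elements is again one when one of them is bounded by `1`
(`ActsNonneg.mul`, by Riesz's expansion of a positive contraction into a series of squares). Since
`0 ≤ x_i ≤ 1` in this sense, the normalized functionals form a compact convex set of sequences, and
for each of them the functionals `L(x_i ·)` and `L((1 - x_i) ·)` are again positive. Hence an extreme
`L` satisfies `L(x_i p) = L(x_i) L(p)` and is the evaluation at a point of the simplex. The
Krein–Milman theorem and the compactness of convex hulls of compact sets in finite dimension give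
the claim.

The ball constraint bounds the moments of `z_k` of degree at most `k` by the mass `(z_k)_0`, so
sequences of bounded mass have coordinatewise limits along ultrafilters, and these limits are
positive functionals (`exists_limit`). Weak duality with the dual pair `(p̂, η)` bounds `⟨p̂, z_k⟩`.
If the masses were unbounded, a limit of the normalized `z_k` would be a state with `L(p̂) ≤ 0`,
although `p̂ > 0` on the simplex (`exists_mass_bound`). So the masses are bounded, hence so are
`â(w_k)` and, by linear independence, `w_k`. At an accumulation point of `w_k`, the vector `â(w)` is
the truncation of a limit functional and lies in the moment cone; closedness of `K` and the
comparison of objective values finish the proof.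
-/

noncomputable section

namespace CPConic

open MvPolynomial Filter Topology

/-! ### Positive functionals on a commutative algebra -/

/-- The orbit of `a` under `a ↦ a - a²`. Since `a = ∑_{k<n} a_k² + a_n`, it expands an element
between `0` and `1` into squares. -/
def logisticSeq {R : Type*} [CommRing R] (a : R) : ℕ → R
  | 0 => a
  | n + 1 => logisticSeq a n - logisticSeq a n ^ 2

theorem sum_sq_logisticSeq {R : Type*} [CommRing R] (a : R) (n : ℕ) :
    ∑ k ∈ Finset.range n, logisticSeq a k ^ 2 + logisticSeq a n = a := by
  induction n with
  | zero => simp [logisticSeq]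
  | succ n ih =>
    rw [Finset.sum_range_succ, logisticSeq]
    linear_combination ih

section Functional

variable {R : Type*} [CommRing R] [Algebra ℝ R]

/-- The elements `a` that act as positive operators in the Gelfand–Naimark–Segal representation of
the functional `L`, that is, `L (a p²) ≥ 0` for all `p`. -/
def ActsNonneg (L : R →ₗ[ℝ] ℝ) (a : R) : Prop := ∀ p : R, 0 ≤ L (a * p ^ 2)

theorem cauchySchwarz {L : R →ₗ[ℝ] ℝ} {u v : R} (h1 : ∀ t : ℝ, 0 ≤ L ((u + t • v) ^ 2)) :
    L (u * v) ^ 2 ≤ L (u ^ 2) * L (v ^ 2) := by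
  have h : ∀ t : ℝ, 0 ≤ L (v ^ 2) * (t * t) + (2 * L (u * v)) * t + L (u ^ 2) := by
    intro t
    have := h1 t
    have e : (u + t • v) ^ 2 = u ^ 2 + (2 * t) • (u * v) + (t * t) • v ^ 2 := by
      simp only [Algebra.smul_def, map_mul, map_ofNat]
      ring
    rw [e, map_add, map_add, map_smul, map_smul, smul_eq_mul, smul_eq_mul] at this
    linarith
  have := discrim_le_zero h
  rw [discrim] at this
  linarith

namespace ActsNonneg

variable {L : R →ₗ[ℝ] ℝ} {a b : R}

theorem apply_nonneg (ha : ActsNonneg L a) : 0 ≤ L a := by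
  simpa using ha 1

theorem add (ha : ActsNonneg L a) (hb : ActsNonneg L b) : ActsNonneg L (a + b) := by
  intro p
  rw [add_mul, map_add]
  exact add_nonneg (ha p) (hb p)

theorem sum {ι : Type*} {s : Finset ι} {f : ι → R} (h : ∀ i ∈ s, ActsNonneg L (f i)) :
    ActsNonneg L (∑ i ∈ s, f i) := by
  intro p
  rw [Finset.sum_mul, map_sum]
  exact Finset.sum_nonneg fun i hi => h i hi p

theorem mul_sq (ha : ActsNonneg L a) (q : R) : ActsNonneg L (a * q ^ 2) := by
  intro p
  rw [mul_assoc, ← mul_pow]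
  exact ha _

theorem logisticSeq_bounds (ha : ActsNonneg L a) (ha' : ActsNonneg L (1 - a)) (n : ℕ) :
    ActsNonneg L (logisticSeq a n) ∧ ActsNonneg L (1 - logisticSeq a n) := by
  have h1 : ActsNonneg L 1 := by simpa using ha.add ha'
  induction n with
  | zero => exact ⟨ha, ha'⟩
  | succ n ih =>
    constructor
    · -- `t - t² = t (1 - t)² + (1 - t) t²`
      have := (ih.1.mul_sq (1 - logisticSeq a n)).add (ih.2.mul_sq (logisticSeq a n))
      convert this using 1
      simp only [logisticSeq]
      ring
    · have := ih.2.add (h1.mul_sq (logisticSeq a n))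
      convert this using 1
      simp only [logisticSeq]
      ring

/-- The product of two commuting positive operators, one of them bounded by `1`, is positive
(F. Riesz): expand the bounded factor as a series of squares. -/
theorem mul (ha : ActsNonneg L a) (ha' : ActsNonneg L (1 - a)) (hb : ActsNonneg L b) :
    ActsNonneg L (a * b) := by
  have h1 : ActsNonneg L 1 := by simpa using ha.add ha'
  intro p
  have hsum : Summable fun k => L ((logisticSeq a k * p) ^ 2) := by
    refine summable_of_sum_range_le (c := L (a * p ^ 2)) (fun k => ?_) (fun n => ?_)
    · simpa using h1 (logisticSeq a k * p)
    · have h := (logisticSeq_bounds ha ha' n).1 p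
      have e : a * p ^ 2 = ∑ k ∈ Finset.range n, (logisticSeq a k * p) ^ 2
          + logisticSeq a n * p ^ 2 := by
        conv_lhs => rw [← sum_sq_logisticSeq a n]
        rw [add_mul, Finset.sum_mul]
        simp only [mul_pow]
      rw [e, map_add, map_sum]
      linarith
  have hlim : Tendsto (fun n => L ((b * p) * (logisticSeq a n * p))) atTop (𝓝 0) := by
    have h0 : Tendsto (fun n => L ((b * p) ^ 2) * L ((logisticSeq a n * p) ^ 2)) atTop (𝓝 0) := by
      simpa using hsum.tendsto_atTop_zero.const_mul (L ((b * p) ^ 2))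
    have h2 : Tendsto (fun n => L ((b * p) * (logisticSeq a n * p)) ^ 2) atTop (𝓝 0) :=
      squeeze_zero (fun n => sq_nonneg _) (fun n => cauchySchwarz fun t => by simpa using h1 _) h0
    have h3 := (Real.continuous_sqrt.tendsto 0).comp h2
    simp only [Function.comp_def, Real.sqrt_sq_eq_abs, Real.sqrt_zero] at h3
    exact (tendsto_zero_iff_abs_tendsto_zero _).2 h3
  refine le_of_tendsto' hlim fun n => ?_
  have e : a * b * p ^ 2 = ∑ k ∈ Finset.range n, b * (logisticSeq a k * p) ^ 2
      + (b * p) * (logisticSeq a n * p) := by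
    conv_lhs => rw [← sum_sq_logisticSeq a n]
    rw [add_mul, add_mul, Finset.sum_mul, Finset.sum_mul]
    congr 1
    · exact Finset.sum_congr rfl fun k _ => by ring
    · ring
  rw [e, map_add, map_sum]
  have := Finset.sum_nonneg fun k (_ : k ∈ Finset.range n) => hb (logisticSeq a k * p)
  linarith

end ActsNonneg

end Functional

/-! ### Convex hulls of compact sets -/

/-- In finite dimension the convex hull of a compact set is compact: by Carathéodory's theorem it is
the image of a compact set of weights and points, with a bounded number of points. -/
theorem isCompact_convexHull_of_isCompact {E : Type*} [NormedAddCommGroup E] [NormedSpace ℝ E]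
    [FiniteDimensional ℝ E] {s : Set E} (hs : IsCompact s) : IsCompact (convexHull ℝ s) := by
  rcases s.eq_empty_or_nonempty with rfl | ⟨x₀, hx₀⟩
  · simp
  -- Affinely independent points number at most `finrank + 1`; shorter combinations are padded with
  -- zero weights at `x₀`.
  let J := Fin (Module.finrank ℝ E + 1)
  let Φ : (J → ℝ) × (J → E) → E := fun q => ∑ j, q.1 j • q.2 j
  have hΦ : Continuous Φ := by fun_prop
  have hK : IsCompact (stdSimplex ℝ J ×ˢ Set.univ.pi fun _ : J => s) :=
    (isCompact_stdSimplex ℝ J).prod (isCompact_univ_pi fun _ => hs)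
  have heq : convexHull ℝ s = Φ '' (stdSimplex ℝ J ×ˢ Set.univ.pi fun _ : J => s) := by
    apply Set.Subset.antisymm
    · intro x hx
      obtain ⟨ι, hι, p, w, hps, hind, hw, hw1, rfl⟩ := eq_pos_convex_span_of_mem_convexHull hx
      have hcard : Fintype.card ι ≤ Fintype.card J := by
        rw [Fintype.card_fin]
        exact hind.card_le_finrank_succ.trans (by gcongr; exact Submodule.finrank_le _)
      obtain ⟨e⟩ := Function.Embedding.nonempty_of_card_le hcard
      refine ⟨(Function.extend e w 0, Function.extend e p fun _ => x₀), ⟨⟨?_, ?_⟩, ?_⟩, ?_⟩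
      · intro j
        by_cases hj : ∃ i, e i = j
        · obtain ⟨i, rfl⟩ := hj
          simpa [e.injective.extend_apply] using (hw i).le
        · simp [Function.extend_apply' _ _ _ hj]
      · rw [← hw1]
        symm
        refine Finset.sum_of_injOn e e.injective.injOn (by simp) ?_ ?_
        · intro j _ hj
          have hj' : ¬ ∃ i, e i = j := by simpa using hj
          simp [Function.extend_apply' _ _ _ hj']
        · intro i _
          simp [e.injective.extend_apply]
      · intro j _
        by_cases hj : ∃ i, e i = j
        · obtain ⟨i, rfl⟩ := hj
          simpa [e.injective.extend_apply] using hps ⟨i, rfl⟩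
        · simpa [Function.extend_apply' _ _ _ hj] using hx₀
      · symm
        refine Finset.sum_of_injOn e e.injective.injOn (by simp) ?_ ?_
        · intro j _ hj
          have hj' : ¬ ∃ i, e i = j := by simpa using hj
          simp [Function.extend_apply' _ _ _ hj']
        · intro i _
          simp [e.injective.extend_apply]
    · rintro _ ⟨q, ⟨⟨hq0, hq1⟩, hq⟩, rfl⟩
      exact (convex_convexHull ℝ s).sum_mem (fun i _ => hq0 i) hq1
        fun i _ => subset_convexHull ℝ s (hq i trivial)
  rw [heq]
  exact hK.image hΦ

/-! ### Positive functionals on polynomials and the moment cone of the simplex -/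

/-- Induction on exponents, one variable at a time. -/
theorem exponent_induction {m : ℕ} {P : (Fin m →₀ ℕ) → Prop} (h0 : P 0)
    (hs : ∀ i α, P α → P (Finsupp.single i 1 + α)) (α : Fin m →₀ ℕ) : P α := by
  have key : ∀ β, P β → P (α + β) := by
    induction α using Finsupp.induction_linear with
    | zero => simp
    | add f g hf hg =>
      intro β hβ
      rw [add_assoc]
      exact hf _ (hg _ hβ)
    | single i n =>
      induction n with
      | zero => simp
      | succ n ih =>
        intro β hβ
        rw [add_comm n 1, Finsupp.single_add, add_assoc]
        exact hs _ _ (ih _ hβ)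
  simpa using key 0 h0

theorem monomial_single_add_one {m : ℕ} (i : Fin m) (α : Fin m →₀ ℕ) :
    (monomial (Finsupp.single i 1 + α) 1 : MvPolynomial (Fin m) ℝ) = X i * monomial α 1 := by
  rw [X, monomial_mul, one_mul]

/-- The linear functional on polynomials whose value at the monomial `x^α` is `z α`. -/
def rieszFunctional {m : ℕ} :
    ((Fin m →₀ ℕ) → ℝ) ≃ₗ[ℝ] (MvPolynomial (Fin m) ℝ →ₗ[ℝ] ℝ) :=
  (basisMonomials (Fin m) ℝ).constr ℝ

theorem rieszFunctional_monomial {m : ℕ} (z : (Fin m →₀ ℕ) → ℝ) (α : Fin m →₀ ℕ) :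
    rieszFunctional z (monomial α 1) = z α := by
  have := (basisMonomials (Fin m) ℝ).constr_basis ℝ z α
  rwa [coe_basisMonomials] at this

theorem rieszFunctional_apply {m : ℕ} (z : (Fin m →₀ ℕ) → ℝ) (p : MvPolynomial (Fin m) ℝ) :
    rieszFunctional z p = ∑ α ∈ p.support, p.coeff α * z α := by
  conv_lhs => rw [p.as_sum, map_sum]
  refine Finset.sum_congr rfl fun α _ => ?_
  have : monomial α (p.coeff α) = p.coeff α • monomial α (1 : ℝ) := by
    rw [smul_monomial, smul_eq_mul, mul_one]
  rw [this, map_smul, rieszFunctional_monomial, smul_eq_mul]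

theorem continuous_rieszFunctional_apply {m : ℕ} (p : MvPolynomial (Fin m) ℝ) :
    Continuous fun z : (Fin m →₀ ℕ) → ℝ => rieszFunctional z p := by
  simp only [rieszFunctional_apply]
  fun_prop

/-- Functionals that are nonnegative on the quadratic module generated by the linear polynomials
`x_i` and `1 - e^T x̄` defining the simplex. -/
structure IsModulePos {m : ℕ} (L : MvPolynomial (Fin m) ℝ →ₗ[ℝ] ℝ) : Prop where
  one : ActsNonneg L 1
  X : ∀ i, ActsNonneg L (X i)
  slack : ActsNonneg L (1 - sumX m)

namespace IsModulePos

variable {m : ℕ} {L : MvPolynomial (Fin m) ℝ →ₗ[ℝ] ℝ}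

theorem one_sub_X (h : IsModulePos L) (i : Fin m) : ActsNonneg L (1 - MvPolynomial.X i) := by
  have := h.slack.add (ActsNonneg.sum (s := Finset.univ.erase i) fun j _ => h.X j)
  convert this using 1
  rw [sumX, ← Finset.add_sum_erase _ _ (Finset.mem_univ i)]
  ring

theorem monomial_bounds (h : IsModulePos L) (α : Fin m →₀ ℕ) :
    ActsNonneg L (monomial α 1) ∧ ActsNonneg L (1 - monomial α 1) := by
  induction α using exponent_induction with
  | h0 =>
    have h0 : ActsNonneg L 0 := by intro p; simp
    simpa using ⟨h.one, h0⟩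
  | hs i α ih =>
    rw [monomial_single_add_one]
    refine ⟨(h.X i).mul (h.one_sub_X i) ih.1, ?_⟩
    convert (h.one_sub_X i).add ((h.X i).mul (h.one_sub_X i) ih.2) using 1
    ring

theorem monomial_mem_Icc (h : IsModulePos L) (α : Fin m →₀ ℕ) :
    L (monomial α 1) ∈ Set.Icc 0 (L 1) := by
  obtain ⟨h1, h2⟩ := h.monomial_bounds α
  have h1 := h1.apply_nonneg
  have h2 := h2.apply_nonneg
  rw [map_sub] at h2
  exact ⟨h1, by linarith⟩

theorem eq_zero (h : IsModulePos L) (h0 : L 1 = 0) : L = 0 := by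
  refine (basisMonomials (Fin m) ℝ).ext fun α => ?_
  have := h.monomial_mem_Icc α
  rw [h0] at this
  rw [coe_basisMonomials, LinearMap.zero_apply]
  exact le_antisymm this.2 this.1

/-- By Riesz's product argument, a bounded positive multiplier preserves positivity on the
quadratic module. -/
theorem comp_mul (h : IsModulePos L) {a : MvPolynomial (Fin m) ℝ} (ha : ActsNonneg L a)
    (ha' : ActsNonneg L (1 - a)) : IsModulePos (L ∘ₗ LinearMap.mulLeft ℝ a) where
  one p := by simpa [mul_assoc] using ha.mul ha' h.one p
  X i p := by simpa [mul_assoc] using ha.mul ha' (h.X i) p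
  slack p := by simpa [mul_assoc] using ha.mul ha' h.slack p

theorem smul (h : IsModulePos L) {c : ℝ} (hc : 0 ≤ c) : IsModulePos (c • L) where
  one p := mul_nonneg hc (h.one p)
  X i p := mul_nonneg hc (h.X i p)
  slack p := mul_nonneg hc (h.slack p)

theorem add {L' : MvPolynomial (Fin m) ℝ →ₗ[ℝ] ℝ} (h : IsModulePos L) (h' : IsModulePos L') :
    IsModulePos (L + L') where
  one p := add_nonneg (h.one p) (h'.one p)
  X i p := add_nonneg (h.X i p) (h'.X i p)
  slack p := add_nonneg (h.slack p) (h'.slack p)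

end IsModulePos

/-- The normalized positive functionals, as sequences of moments. -/
def stateSet (m : ℕ) : Set ((Fin m →₀ ℕ) → ℝ) :=
  {z | z 0 = 1 ∧ IsModulePos (rieszFunctional z)}

theorem rieszFunctional_one {m : ℕ} (z : (Fin m →₀ ℕ) → ℝ) : rieszFunctional z 1 = z 0 :=
  rieszFunctional_monomial z 0

theorem convex_stateSet (m : ℕ) : Convex ℝ (stateSet m) := by
  intro z hz z' hz' s t hs ht hst
  refine ⟨?_, ?_⟩
  · simp [hz.1, hz'.1, hst]
  · rw [map_add, map_smul, map_smul]
    exact (hz.2.smul hs).add (hz'.2.smul ht)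

theorem isCompact_stateSet (m : ℕ) : IsCompact (stateSet m) := by
  have hbox : IsCompact (Set.univ.pi fun _ : Fin m →₀ ℕ => Set.Icc (0 : ℝ) 1) :=
    isCompact_univ_pi fun _ => isCompact_Icc
  refine hbox.of_isClosed_subset ?_ ?_
  · have hset : stateSet m = {z | z 0 = 1} ∩
        ((⋂ p, {z | 0 ≤ rieszFunctional z (1 * p ^ 2)}) ∩
          ((⋂ i, ⋂ p, {z | 0 ≤ rieszFunctional z (X i * p ^ 2)}) ∩
            ⋂ p, {z | 0 ≤ rieszFunctional z ((1 - sumX m) * p ^ 2)})) := by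
      ext z
      simp only [Set.mem_inter_iff, Set.mem_iInter, Set.mem_ofPred_eq]
      exact ⟨fun h => ⟨h.1, h.2.one, h.2.X, h.2.slack⟩, fun h => ⟨h.1, h.2.1, h.2.2.1, h.2.2.2⟩⟩
    have hc : ∀ p : MvPolynomial (Fin m) ℝ, IsClosed {z | 0 ≤ rieszFunctional z p} := fun p =>
      isClosed_le continuous_const (continuous_rieszFunctional_apply p)
    rw [hset]
    exact (isClosed_eq (continuous_apply 0) continuous_const).inter
      ((isClosed_iInter fun p => hc _).inter
        ((isClosed_iInter fun i => isClosed_iInter fun p => hc _).inter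
          (isClosed_iInter fun p => hc _)))
  · intro z hz α _
    have := hz.2.monomial_mem_Icc α
    rwa [rieszFunctional_monomial, rieszFunctional_one, hz.1] at this

/-- At an extreme state `L`, the functional `L (a ·)` is proportional to `L`: otherwise
`L = L (a ·) + L ((1 - a) ·)` would be a nontrivial decomposition. -/
theorem apply_mul_of_mem_extremePoints {m : ℕ} {z : (Fin m →₀ ℕ) → ℝ}
    (hz : z ∈ (stateSet m).extremePoints ℝ) {a : MvPolynomial (Fin m) ℝ}
    (ha : ActsNonneg (rieszFunctional z) a) (ha' : ActsNonneg (rieszFunctional z) (1 - a))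
    (p : MvPolynomial (Fin m) ℝ) :
    rieszFunctional z (a * p) = rieszFunctional z a * rieszFunctional z p := by
  set L := rieszFunctional z with hL
  have hpos : IsModulePos L := hz.1.2
  have hL1 : L 1 = 1 := by rw [hL, rieszFunctional_one, hz.1.1]
  have h1 := hpos.comp_mul ha ha'
  have h2 := hpos.comp_mul ha' (by simpa using ha)
  have hsplit : L (a * p) + L ((1 - a) * p) = L p := by rw [← map_add]; congr 1; ring
  have ht0 := ha.apply_nonneg
  have ht1 := ha'.apply_nonneg
  have hta : L (1 - a) = 1 - L a := by rw [map_sub, hL1]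
  rw [hta] at ht1
  -- If `L a` or `L (1 - a)` vanishes, so does the whole functional `L (a ·)` or `L ((1 - a) ·)`.
  rcases ht0.eq_or_lt with ht0 | ht0
  · have := LinearMap.congr_fun (h1.eq_zero (by simpa using ht0.symm)) p
    simp only [LinearMap.comp_apply, LinearMap.mulLeft_apply, LinearMap.zero_apply] at this
    rw [this, ← ht0, zero_mul]
  rcases ht1.eq_or_lt with ht1 | ht1
  · have := LinearMap.congr_fun (h2.eq_zero (by simpa [hta] using ht1.symm)) p
    simp only [LinearMap.comp_apply, LinearMap.mulLeft_apply, LinearMap.zero_apply] at this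
    rw [this, add_zero] at hsplit
    rw [hsplit, show L a = 1 by linarith, one_mul]
  have mem : ∀ b : MvPolynomial (Fin m) ℝ, 0 < L b → IsModulePos (L ∘ₗ LinearMap.mulLeft ℝ b) →
      rieszFunctional.symm ((L b)⁻¹ • (L ∘ₗ LinearMap.mulLeft ℝ b)) ∈ stateSet m := by
    intro b hb hpb
    refine ⟨?_, ?_⟩
    · rw [← rieszFunctional_one (rieszFunctional.symm _), LinearEquiv.apply_symm_apply]
      simp [hb.ne']
    · rw [LinearEquiv.apply_symm_apply]
      exact hpb.smul (inv_nonneg.2 hb.le)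
  have hb1 : 0 < L (1 - a) := by rwa [hta]
  have hext := (mem_extremePoints.1 hz).2 _ (mem a ht0 h1) _ (mem (1 - a) hb1 h2)
    ⟨L a, L (1 - a), ht0, hb1, by rw [hta]; ring, by
      apply rieszFunctional.injective
      rw [map_add, map_smul rieszFunctional, map_smul rieszFunctional,
        LinearEquiv.apply_symm_apply, LinearEquiv.apply_symm_apply, smul_inv_smul₀ ht0.ne',
        smul_inv_smul₀ hb1.ne']
      refine LinearMap.ext fun q => ?_
      simp only [LinearMap.add_apply, LinearMap.comp_apply, LinearMap.mulLeft_apply]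
      rw [← map_add]
      congr 1
      ring⟩
  have := congrArg (fun y => rieszFunctional y p) hext.1
  simp only [LinearEquiv.apply_symm_apply, LinearMap.smul_apply, LinearMap.comp_apply,
    LinearMap.mulLeft_apply, smul_eq_mul] at this
  rw [← hL] at this
  rw [← this]
  field_simp

/-- The extreme states are the evaluations at the points of the simplex. -/
theorem exists_eq_monomial_of_mem_extremePoints {m : ℕ} {z : (Fin m →₀ ℕ) → ℝ}
    (hz : z ∈ (stateSet m).extremePoints ℝ) :
    ∃ v ∈ simplexBar m, ∀ α, z α = ∏ i, v i ^ α i := by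
  have hpos : IsModulePos (rieszFunctional z) := hz.1.2
  refine ⟨fun i => rieszFunctional z (X i), ⟨fun i => (hpos.X i).apply_nonneg, ?_⟩, ?_⟩
  · have := hpos.slack.apply_nonneg
    rwa [map_sub, rieszFunctional_one, hz.1.1, sumX, map_sum] at this
  · intro α
    rw [← rieszFunctional_monomial z α]
    induction α using exponent_induction with
    | h0 => simpa [rieszFunctional_one] using hz.1.1
    | hs i α ih =>
      rw [monomial_single_add_one, apply_mul_of_mem_extremePoints hz (hpos.X i) (hpos.one_sub_X i),
        ih]
      simp only [Finsupp.add_apply, pow_add, Finset.prod_mul_distrib]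
      congr 1
      rw [Finset.prod_eq_single i]
      · simp
      · intro j _ hj
        simp [Finsupp.single_eq_of_ne hj]
      · simp

/-- The truncation to degree `d` of an untruncated sequence of moments. -/
def truncSeq {m : ℕ} (d : ℕ) : ((Fin m →₀ ℕ) → ℝ) →ₗ[ℝ] Tms m d where
  toFun z α := z α.1
  map_add' _ _ := rfl
  map_smul' _ _ := rfl

theorem isCompact_simplexBar (m : ℕ) : IsCompact (simplexBar m) := by
  have hbox : IsCompact (Set.univ.pi fun _ : Fin m => Set.Icc (0 : ℝ) 1) :=
    isCompact_univ_pi fun _ => isCompact_Icc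
  refine hbox.of_isClosed_subset ?_ fun x hx i _ => ⟨hx.1 i, ?_⟩
  · have : simplexBar m = (⋂ i, {x | 0 ≤ x i}) ∩ {x | 0 ≤ 1 - ∑ i, x i} := by
      ext x
      simp [simplexBar]
    rw [this]
    exact (isClosed_iInter fun i => isClosed_le continuous_const (continuous_apply i)).inter
      (isClosed_le continuous_const (by fun_prop))
  · have := Finset.single_le_sum (fun j _ => hx.1 j) (Finset.mem_univ i)
    have := hx.2
    linarith

/-- The truncated moments of a state are convex combinations of the vectors `[v]_d`. This is the
truncated form of Putinar's theorem, obtained here from the Krein–Milman theorem. -/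
theorem truncSeq_mem_convexHull {m : ℕ} (d : ℕ) {z : (Fin m →₀ ℕ) → ℝ} (hz : z ∈ stateSet m) :
    truncSeq d z ∈ convexHull ℝ (monoVec d '' simplexBar m) := by
  have hcont : Continuous (truncSeq (m := m) d) :=
    continuous_pi fun α => continuous_apply (A := fun _ => ℝ) α.1
  have hmono : Continuous (monoVec (m := m) d) := by
    unfold monoVec
    fun_prop
  have hclosed : IsClosed (convexHull ℝ (monoVec d '' simplexBar m)) :=
    (isCompact_convexHull_of_isCompact ((isCompact_simplexBar m).image hmono)).isClosed
  rw [← closure_convexHull_extremePoints (isCompact_stateSet m) (convex_stateSet m)] at hz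
  have h1 := image_closure_subset_closure_image hcont (Set.mem_image_of_mem _ hz)
  rw [LinearMap.image_convexHull] at h1
  refine closure_minimal (convexHull_mono ?_) hclosed h1
  rintro _ ⟨y, hy, rfl⟩
  obtain ⟨v, hv, hyv⟩ := exists_eq_monomial_of_mem_extremePoints hy
  exact ⟨v, hv, funext fun α => (hyv α.1).symm⟩

theorem exists_fin_sum_of_mem_convexHull {m d : ℕ} {y : Tms m d}
    (hy : y ∈ convexHull ℝ (monoVec d '' simplexBar m)) :
    ∃ (r : ℕ) (lam : Fin r → ℝ) (v : Fin r → Fin m → ℝ), (∀ i, 0 ≤ lam i) ∧ ∑ i, lam i = 1 ∧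
      (∀ i, v i ∈ simplexBar m) ∧ y = ∑ i, lam i • monoVec d (v i) := by
  obtain ⟨ι, _, w, p, hw, hw1, hp, rfl⟩ := mem_convexHull_iff_exists_fintype.1 hy
  choose v hv hvp using hp
  let e := Fintype.equivFin ι
  refine ⟨Fintype.card ι, w ∘ e.symm, v ∘ e.symm, fun i => hw _, ?_, fun i => hv _, ?_⟩
  · rw [← hw1]
    exact e.symm.sum_comp w
  · rw [← e.symm.sum_comp]
    simp [hvp]

/-- Truncations of functionals that are nonnegative on the quadratic module lie in the moment
cone. -/
theorem truncSeq_mem_momentCone {m : ℕ} (d : ℕ) {z : (Fin m →₀ ℕ) → ℝ}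
    (hz : IsModulePos (rieszFunctional z)) : truncSeq d z ∈ momentCone m d := by
  have h0 : 0 ≤ z 0 := by
    have := hz.one.apply_nonneg
    rwa [rieszFunctional_one] at this
  rcases h0.eq_or_lt with h0 | h0
  · have : z = 0 := by
      apply rieszFunctional.injective
      rw [map_zero]
      exact hz.eq_zero (by rw [rieszFunctional_one, h0])
    exact ⟨0, Fin.elim0, Fin.elim0, fun i => i.elim0, fun i => i.elim0, by simp [this]⟩
  · have hmem : (z 0)⁻¹ • z ∈ stateSet m :=
      ⟨by simp [h0.ne'], by rw [map_smul]; exact hz.smul (inv_nonneg.2 h0.le)⟩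
    obtain ⟨r, lam, v, hlam, -, hv, hsum⟩ :=
      exists_fin_sum_of_mem_convexHull (truncSeq_mem_convexHull d hmem)
    refine ⟨r, fun i => z 0 * lam i, v, fun i => mul_nonneg h0.le (hlam i), hv, ?_⟩
    simp only [mul_smul]
    rw [← Finset.smul_sum, ← hsum, map_smul, smul_inv_smul₀ h0.ne']

theorem pair_eq_rieszFunctional {m d : ℕ} {p : MvPolynomial (Fin m) ℝ} (hp : p.totalDegree ≤ d)
    (z : (Fin m →₀ ℕ) → ℝ) : pair p (truncSeq d z) = rieszFunctional z p := by
  rw [rieszFunctional_apply, pair]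
  symm
  refine Finset.sum_bij_ne_zero (fun α hα _ => ⟨α, (le_totalDegree hα).trans hp⟩)
    (fun _ _ _ => Finset.mem_univ _) ?_ ?_ ?_
  · intro a _ _ b _ _ h
    exact congrArg Subtype.val h
  · intro α _ hα
    refine ⟨α.1, ?_, hα, rfl⟩
    rw [mem_support_iff]
    exact left_ne_zero_of_mul hα
  · intro α _ _
    rfl

theorem pair_monoVec {m d : ℕ} {p : MvPolynomial (Fin m) ℝ} (hp : p.totalDegree ≤ d)
    (v : Fin m → ℝ) : pair p (monoVec d v) = eval v p := by
  rw [eval_eq', ← rieszFunctional_apply fun α => ∏ i, v i ^ α i, ← pair_eq_rieszFunctional hp]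
  rfl

/-- `⟨p, ·⟩` as a linear functional. -/
def pairLinear {m : ℕ} (d : ℕ) (p : MvPolynomial (Fin m) ℝ) : Tms m d →ₗ[ℝ] ℝ where
  toFun z := pair p z
  map_add' y z := by simp only [pair, Pi.add_apply, mul_add, Finset.sum_add_distrib]
  map_smul' c z := by
    simp only [pair, Pi.smul_apply, smul_eq_mul, Finset.mul_sum, RingHom.id_apply]
    exact Finset.sum_congr rfl fun _ _ => by ring

/-- A state is positive at every polynomial that is positive on the simplex. -/
theorem rieszFunctional_pos_of_mem_stateSet {m : ℕ} {z : (Fin m →₀ ℕ) → ℝ} (hz : z ∈ stateSet m)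
    {p : MvPolynomial (Fin m) ℝ} (hp : ∀ x ∈ simplexBar m, 0 < eval x p) :
    0 < rieszFunctional z p := by
  obtain ⟨r, lam, v, hlam, hlam1, hv, hsum⟩ :=
    exists_fin_sum_of_mem_convexHull (truncSeq_mem_convexHull p.totalDegree hz)
  rw [← pair_eq_rieszFunctional le_rfl, hsum]
  change 0 < pairLinear _ p _
  rw [map_sum]
  have hterm : ∀ i, pairLinear p.totalDegree p (lam i • monoVec p.totalDegree (v i))
      = lam i * eval (v i) p := by
    intro i
    rw [map_smul, smul_eq_mul, ← pair_monoVec le_rfl]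
    rfl
  simp only [hterm]
  obtain ⟨i, -, hi⟩ : ∃ i ∈ Finset.univ, 0 < lam i := by
    apply Finset.exists_lt_of_sum_lt
    simp [hlam1]
  exact Finset.sum_pos' (fun j _ => mul_nonneg (hlam j) (hp _ (hv j)).le)
    ⟨i, Finset.mem_univ i, mul_pos hi (hp _ (hv i))⟩

/-! ### Truncated positivity and limits of truncated sequences -/

/-- `⟨·, z⟩` as a linear functional on all polynomials; coefficients of degree above `d` are
ignored. -/
def pairFunctional {m d : ℕ} (z : Tms m d) : MvPolynomial (Fin m) ℝ →ₗ[ℝ] ℝ where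
  toFun p := pair p z
  map_add' p q := by simp only [pair, coeff_add, add_mul, Finset.sum_add_distrib]
  map_smul' c p := by
    simp only [pair, coeff_smul, smul_eq_mul, Finset.mul_sum, mul_assoc, RingHom.id_apply]

theorem pairFunctional_monomial {m d : ℕ} (z : Tms m d) (α : Expo m d) :
    pairFunctional z (monomial α.1 1) = z α := by
  classical
  change ∑ β : Expo m d, coeff β.1 (monomial α.1 1) * z β = z α
  rw [Finset.sum_eq_single α]
  · simp
  · intro β _ hβ
    have : α.1 ≠ β.1 := fun h => hβ (Subtype.ext h.symm)
    simp [coeff_monomial, this]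
  · simp

theorem pairFunctional_trunc {m d e : ℕ} (h : d ≤ e) (z : Tms m e) {p : MvPolynomial (Fin m) ℝ}
    (hp : p.totalDegree ≤ d) : pair p (trunc h z) = pairFunctional z p := by
  refine Finset.sum_bij_ne_zero (fun α _ _ => ⟨α.1, α.2.trans h⟩) (fun _ _ _ => Finset.mem_univ _)
    ?_ ?_ ?_
  · intro a _ _ b _ _ hab
    have hab' := congrArg Subtype.val hab
    exact Subtype.ext hab'
  · intro α _ hα
    have hα' : α.1 ∈ p.support := mem_support_iff.2 (left_ne_zero_of_mul hα)
    exact ⟨⟨α.1, (le_totalDegree hα').trans hp⟩, Finset.mem_univ _, hα, rfl⟩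
  · intro α _ _
    rfl

theorem sum_monomial_coeff {m e : ℕ} {p : MvPolynomial (Fin m) ℝ} (hp : p.totalDegree ≤ e) :
    ∑ α : Expo m e, monomial α.1 (p.coeff α.1) = p := by
  conv_rhs => rw [p.as_sum]
  symm
  refine Finset.sum_bij_ne_zero (fun α hα _ => ⟨α, (le_totalDegree hα).trans hp⟩)
    (fun _ _ _ => Finset.mem_univ _) ?_ ?_ ?_
  · intro a _ _ b _ _ h
    exact congrArg Subtype.val h
  · intro α _ hα
    refine ⟨α.1, ?_, hα, rfl⟩
    rw [mem_support_iff]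
    rintro h
    exact hα (by rw [h, monomial_zero])
  · intro α _ _
    rfl

theorem localizingMatrix_quadraticForm {m k : ℕ} (q : MvPolynomial (Fin m) ℝ) (z : Tms m (2 * k))
    {p : MvPolynomial (Fin m) ℝ} (hp : p.totalDegree ≤ (2 * k - q.totalDegree) / 2) :
    (fun α : Expo m ((2 * k - q.totalDegree) / 2) => p.coeff α.1) ⬝ᵥ
      (localizingMatrix k q z *ᵥ fun α => p.coeff α.1) = pairFunctional z (q * p ^ 2) := by
  have hexp : q * p ^ 2 = ∑ α : Expo m ((2 * k - q.totalDegree) / 2),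
      ∑ β : Expo m ((2 * k - q.totalDegree) / 2),
        (p.coeff α.1 * p.coeff β.1) • (q * monomial (α.1 + β.1) 1) := by
    conv_lhs => rw [← sum_monomial_coeff hp, sq, Finset.sum_mul_sum, Finset.mul_sum]
    refine Finset.sum_congr rfl fun α _ => ?_
    rw [Finset.mul_sum]
    refine Finset.sum_congr rfl fun β _ => ?_
    rw [monomial_mul, ← mul_smul_comm, smul_monomial, smul_eq_mul, mul_one]
  rw [hexp, map_sum, dotProduct]
  refine Finset.sum_congr rfl fun α _ => ?_
  rw [map_sum, Matrix.mulVec, dotProduct, Finset.mul_sum]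
  refine Finset.sum_congr rfl fun β _ => ?_
  rw [map_smul, smul_eq_mul]
  change p.coeff α.1 * (pairFunctional z (q * monomial (α.1 + β.1) 1) * p.coeff β.1) = _
  ring

theorem pairFunctional_nonneg_of_posSemidef {m k : ℕ} {q : MvPolynomial (Fin m) ℝ}
    {z : Tms m (2 * k)} (h : (localizingMatrix k q z).PosSemidef) {p : MvPolynomial (Fin m) ℝ}
    (hp : q.totalDegree + 2 * p.totalDegree ≤ 2 * k) : 0 ≤ pairFunctional z (q * p ^ 2) := by
  rw [← localizingMatrix_quadraticForm q z (by omega)]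
  simpa using h.dotProduct_mulVec_nonneg _

/-- The localizing matrix of `[v]_{2k}` is `q(v)` times a rank-one Gram matrix. -/
theorem localizingMatrix_monoVec {m k : ℕ} {q : MvPolynomial (Fin m) ℝ}
    (hq : q.totalDegree ≤ 2 * k) (v : Fin m → ℝ) :
    localizingMatrix k q (monoVec (2 * k) v) =
      eval v q • Matrix.vecMulVec (monoVec ((2 * k - q.totalDegree) / 2) v)
        (star (monoVec ((2 * k - q.totalDegree) / 2) v)) := by
  ext α β
  have hdeg : (q * monomial (α.1 + β.1) (1 : ℝ)).totalDegree ≤ 2 * k := by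
    refine (totalDegree_mul _ _).trans ?_
    rw [totalDegree_monomial _ one_ne_zero]
    change _ + (α.1 + β.1).degree ≤ _
    rw [map_add]
    have := α.2
    have := β.2
    omega
  change pair _ _ = _
  rw [pair_monoVec hdeg, map_mul, eval_monomial, one_mul, Finsupp.prod_fintype _ _ (by simp)]
  simp [Matrix.vecMulVec_apply, monoVec, pow_add, Finset.prod_mul_distrib]

theorem posSemidef_localizingMatrix_sum {m k r : ℕ} {q : MvPolynomial (Fin m) ℝ}
    (hq : q.totalDegree ≤ 2 * k) {lam : Fin r → ℝ} {v : Fin r → Fin m → ℝ} (hlam : ∀ i, 0 ≤ lam i)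
    (hv : ∀ i, 0 ≤ eval (v i) q) :
    (localizingMatrix k q (∑ i, lam i • monoVec (2 * k) (v i))).PosSemidef := by
  have hsum : localizingMatrix k q (∑ i, lam i • monoVec (2 * k) (v i))
      = ∑ i, lam i • localizingMatrix k q (monoVec (2 * k) (v i)) := by
    ext α β
    rw [Matrix.sum_apply]
    change pairLinear _ _ _ = _
    rw [map_sum]
    refine Finset.sum_congr rfl fun i _ => ?_
    rw [map_smul]
    rfl
  rw [hsum]
  refine Matrix.posSemidef_sum _ fun i _ => ?_
  rw [localizingMatrix_monoVec hq]
  exact ((Matrix.posSemidef_vecMulVec_self_star _).smul (hv i)).smul (hlam i)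

theorem pairFunctional_smul {m k : ℕ} {z : Tms m (2 * k)} (c : ℝ) (p : MvPolynomial (Fin m) ℝ) :
    pairFunctional (c • z) p = c * pairFunctional z p :=
  (pairLinear (2 * k) p).map_smul c z

/-- The constraints of the moment relaxation as inequalities for `⟨·, z⟩`. -/
structure IsTruncPos {m k : ℕ} (z : Tms m (2 * k)) : Prop where
  one : ∀ p, p.totalDegree ≤ k → 0 ≤ pairFunctional z (p ^ 2)
  X : ∀ i p, p.totalDegree + 1 ≤ k → 0 ≤ pairFunctional z (X i * p ^ 2)
  slack : ∀ p, p.totalDegree + 1 ≤ k → 0 ≤ pairFunctional z ((1 - sumX m) * p ^ 2)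
  ball : ∀ p, p.totalDegree + 1 ≤ k →
    0 ≤ pairFunctional z ((1 - ∑ i, MvPolynomial.X i ^ 2) * p ^ 2)

theorem totalDegree_slack_le (m : ℕ) : (1 - sumX m).totalDegree ≤ 1 := by
  refine (totalDegree_sub _ _).trans (max_le (by simp) ?_)
  refine totalDegree_finsetSum_le fun i _ => ?_
  simp

theorem totalDegree_ball_le (m : ℕ) :
    (1 - ∑ i : Fin m, X i ^ 2 : MvPolynomial (Fin m) ℝ).totalDegree ≤ 2 := by
  refine (totalDegree_sub _ _).trans (max_le (by simp) ?_)
  refine totalDegree_finsetSum_le fun i _ => ?_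
  refine (totalDegree_pow _ _).trans ?_
  simp

theorem totalDegree_monomial_one_le {m : ℕ} (α : Fin m →₀ ℕ) :
    (monomial α (1 : ℝ)).totalDegree ≤ α.degree := by
  rw [totalDegree_monomial _ one_ne_zero]
  rfl

namespace IsTruncPos

variable {m k : ℕ} {z : Tms m (2 * k)}

theorem of_posSemidef (h1 : (momentMatrix k z).PosSemidef)
    (hX : ∀ i : Fin m, (localizingMatrix k (MvPolynomial.X i) z).PosSemidef)
    (hs : (localizingMatrix k (1 - sumX m) z).PosSemidef)
    (hb : (localizingMatrix k (1 - ∑ i : Fin m, MvPolynomial.X i ^ 2) z).PosSemidef) :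
    IsTruncPos z where
  one p hp := by
    have := pairFunctional_nonneg_of_posSemidef (p := p) h1 (by simpa using hp)
    rwa [one_mul] at this
  X i p hp := pairFunctional_nonneg_of_posSemidef (hX i) (by rw [totalDegree_X]; omega)
  slack p hp := pairFunctional_nonneg_of_posSemidef hs (by
    have := totalDegree_slack_le m
    omega)
  ball p hp := pairFunctional_nonneg_of_posSemidef hb (by
    have := totalDegree_ball_le m
    omega)

theorem smul (h : IsTruncPos z) {c : ℝ} (hc : 0 ≤ c) : IsTruncPos (c • z) where
  one p hp := by rw [pairFunctional_smul]; exact mul_nonneg hc (h.one p hp)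
  X i p hp := by rw [pairFunctional_smul]; exact mul_nonneg hc (h.X i p hp)
  slack p hp := by rw [pairFunctional_smul]; exact mul_nonneg hc (h.slack p hp)
  ball p hp := by rw [pairFunctional_smul]; exact mul_nonneg hc (h.ball p hp)

/-- The ball constraint makes the diagonal of the moment matrix decrease along multiplication by a
variable. -/
theorem monomial_sq_le (h : IsTruncPos z) (α : Fin m →₀ ℕ) (hα : α.degree ≤ k) :
    pairFunctional z (monomial α 1 ^ 2) ≤ pairFunctional z 1 := by
  induction α using exponent_induction with
  | h0 => simp
  | hs i α ih =>
    rw [map_add, Finsupp.degree_single] at hα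
    refine le_trans ?_ (ih (by omega))
    have hdeg := totalDegree_monomial_one_le α
    have hball := h.ball (monomial α 1) (by omega)
    have hother : 0 ≤ pairFunctional z (∑ j ∈ Finset.univ.erase i,
        (MvPolynomial.X j * monomial α 1) ^ 2) := by
      rw [map_sum]
      refine Finset.sum_nonneg fun j _ => h.one _ ?_
      refine (totalDegree_mul _ _).trans ?_
      rw [totalDegree_X]
      omega
    have hadd := add_nonneg hball hother
    rw [← map_add] at hadd
    have e : (1 - ∑ i : Fin m, MvPolynomial.X i ^ 2) * monomial α (1 : ℝ) ^ 2
        + ∑ j ∈ Finset.univ.erase i, (MvPolynomial.X j * monomial α 1) ^ 2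
        = monomial α 1 ^ 2 - monomial (Finsupp.single i 1 + α) 1 ^ 2 := by
      rw [monomial_single_add_one, ← Finset.add_sum_erase _ _ (Finset.mem_univ i)]
      simp only [mul_pow]
      rw [← Finset.sum_mul]
      ring
    rw [e, map_sub] at hadd
    linarith

theorem abs_monomial_le (h : IsTruncPos z) (α : Fin m →₀ ℕ) (hα : α.degree ≤ k) :
    |pairFunctional z (monomial α 1)| ≤ pairFunctional z 1 := by
  have h0 : 0 ≤ pairFunctional z 1 := by simpa using h.one 1 (by simp)
  have hcs := cauchySchwarz (L := pairFunctional z) (u := monomial α 1) (v := 1) fun t =>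
    h.one _ ((totalDegree_add _ _).trans (max_le ((totalDegree_monomial_one_le α).trans hα)
      ((totalDegree_smul_le _ _).trans (by simp))))
  rw [mul_one, one_pow] at hcs
  refine abs_le_of_sq_le_sq (hcs.trans ?_) h0
  rw [sq (pairFunctional z 1)]
  exact mul_le_mul_of_nonneg_right (h.monomial_sq_le α hα) h0

end IsTruncPos

/-- Truncated positive sequences of growing order and bounded mass have, along an ultrafilter, a
limit that is positive on the whole quadratic module. -/
theorem exists_limit {m : ℕ} {U : Ultrafilter ℕ} (hU : (U : Filter ℕ) ≤ atTop)
    {y : (k : ℕ) → Tms m (2 * k)} (hy : ∀ᶠ k in U, IsTruncPos (y k)) {B : ℝ}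
    (hB : ∀ᶠ k in U, pairFunctional (y k) 1 ≤ B) :
    ∃ z : (Fin m →₀ ℕ) → ℝ, IsModulePos (rieszFunctional z) ∧
      ∀ p, Tendsto (fun k => pairFunctional (y k) p) U (𝓝 (rieszFunctional z p)) := by
  have hex : ∀ α : Fin m →₀ ℕ, ∃ t,
      Tendsto (fun k => pairFunctional (y k) (monomial α 1)) U (𝓝 t) := by
    intro α
    have hmem : ∀ᶠ k in U, pairFunctional (y k) (monomial α 1) ∈ Set.Icc (-B) B := by
      filter_upwards [hy, hB, hU (eventually_ge_atTop α.degree)] with k h1 h2 h3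
      exact abs_le.1 ((h1.abs_monomial_le α h3).trans h2)
    obtain ⟨t, -, ht⟩ := isCompact_Icc.ultrafilter_le_nhds
      (U.map fun k => pairFunctional (y k) (monomial α 1)) (le_principal_iff.2 hmem)
    exact ⟨t, ht⟩
  choose z hz using hex
  have hlim : ∀ p, Tendsto (fun k => pairFunctional (y k) p) U (𝓝 (rieszFunctional z p)) := by
    intro p
    induction p using MvPolynomial.induction_on' with
    | monomial α a =>
      have e : monomial α a = a • monomial α (1 : ℝ) := by rw [smul_monomial, smul_eq_mul, mul_one]
      simp only [e, map_smul, rieszFunctional_monomial]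
      exact (hz α).const_smul a
    | add p q hp hq =>
      simp only [map_add]
      exact hp.add hq
  refine ⟨z, ⟨fun p => ?_, fun i p => ?_, fun p => ?_⟩, hlim⟩
  · refine ge_of_tendsto (hlim _) ?_
    filter_upwards [hy, hU (eventually_ge_atTop p.totalDegree)] with k h1 h2
    rw [one_mul]
    exact h1.one p h2
  · refine ge_of_tendsto (hlim _) ?_
    filter_upwards [hy, hU (eventually_ge_atTop (p.totalDegree + 1))] with k h1 h2
    exact h1.X i p h2
  · refine ge_of_tendsto (hlim _) ?_
    filter_upwards [hy, hU (eventually_ge_atTop (p.totalDegree + 1))] with k h1 h2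
    exact h1.slack p h2

/-- The masses of truncated positive sequences stay bounded as soon as `⟨p, ·⟩` does, for some `p`
positive on the simplex: a normalized limit would be a state at which `p` is not positive. -/
theorem exists_mass_bound {y : (k : ℕ) → Tms m (2 * k)} (hy : ∀ᶠ k in atTop, IsTruncPos (y k))
    {p : MvPolynomial (Fin m) ℝ} (hp : ∀ x ∈ simplexBar m, 0 < eval x p) {C : ℝ}
    (hC : ∀ᶠ k in atTop, pairFunctional (y k) p ≤ C) :
    ∃ B, ∀ᶠ k in atTop, pairFunctional (y k) 1 ≤ B := by
  by_contra hcon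
  push Not at hcon
  obtain ⟨φ, hφ, hlt⟩ := extraction_forall_of_frequently fun n : ℕ => hcon n
  let U : Ultrafilter ℕ := (hyperfilter ℕ).map φ
  have hU : (U : Filter ℕ) ≤ atTop := hφ.tendsto_atTop.mono_left Nat.hyperfilter_le_atTop
  have hmass : Tendsto (fun k => pairFunctional (y k) 1) U atTop := by
    change Tendsto _ (Filter.map φ _) _
    rw [tendsto_map'_iff]
    exact (tendsto_atTop_mono (fun n => (hlt n).le) tendsto_natCast_atTop_atTop).mono_left
      Nat.hyperfilter_le_atTop
  have hpos : ∀ᶠ k in U, 0 < pairFunctional (y k) 1 := hmass.eventually_gt_atTop 0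
  have hunit : ∀ᶠ k in U, pairFunctional ((pairFunctional (y k) 1)⁻¹ • y k) 1 = 1 := by
    filter_upwards [hpos] with k hk
    rw [pairFunctional_smul, inv_mul_cancel₀ hk.ne']
  obtain ⟨z, hz, hlim⟩ := exists_limit hU
    (y := fun k => (pairFunctional (y k) 1)⁻¹ • y k) (B := 1)
    (by
      filter_upwards [hU hy, hpos] with k h1 h2
      exact h1.smul (inv_nonneg.2 h2.le))
    (hunit.mono fun k hk => hk.le)
  have hz1 : z 0 = 1 := by
    rw [← rieszFunctional_one z]
    exact tendsto_nhds_unique (hlim 1) (tendsto_const_nhds.congr' (hunit.mono fun k hk => hk.symm))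
  have hzp := rieszFunctional_pos_of_mem_stateSet ⟨hz1, hz⟩ hp
  have h0 : Tendsto (fun k => (pairFunctional (y k) 1)⁻¹ * C) U (𝓝 0) := by
    simpa using hmass.inv_tendsto_atTop.mul_const C
  refine absurd (le_of_tendsto_of_tendsto (hlim p) h0 ?_) (not_le.2 hzp)
  filter_upwards [hpos, hU hC] with k h1 h2
  rw [pairFunctional_smul]
  exact mul_le_mul_of_nonneg_left h2 (inv_nonneg.2 h1.le)

/-! ### The conic problem and its relaxations -/

theorem isClosed_symPosSemidef (t : ℕ) :
    IsClosed {M : SymMatrix t | (M : Matrix (Fin t) (Fin t) ℝ).PosSemidef} := by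
  have heq : {M : SymMatrix t | (M : Matrix (Fin t) (Fin t) ℝ).PosSemidef}
      = ⋂ x : Fin t → ℝ, {M : SymMatrix t | 0 ≤ x ⬝ᵥ ((M : Matrix (Fin t) (Fin t) ℝ) *ᵥ x)} := by
    ext M
    rw [Set.mem_iInter]
    constructor
    · intro h x
      simpa using Matrix.PosSemidef.dotProduct_mulVec_nonneg h x
    · intro h
      refine Matrix.PosSemidef.of_dotProduct_mulVec_nonneg ?_ fun x => by simpa using h x
      rw [Matrix.IsHermitian, Matrix.conjTranspose_eq_transpose_of_trivial]
      exact M.2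
  rw [heq]
  refine isClosed_iInter fun x => isClosed_le continuous_const ?_
  exact Continuous.dotProduct continuous_const
    (Continuous.matrix_mulVec continuous_subtype_val continuous_const)

theorem ConeFormat.isClosed_cone (F : ConeFormat) : IsClosed F.cone := by
  have heq : F.cone = (⋂ i, {u : F.Space | 0 ≤ u.1 i}) ∩
      ((⋂ j, {u : F.Space | ‖(u.2.1 j).2‖ ≤ (u.2.1 j).1}) ∩
        ⋂ j, {u : F.Space | (u.2.2 j : Matrix (Fin (F.sdp j)) (Fin (F.sdp j)) ℝ).PosSemidef}) := by
    ext u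
    simp [ConeFormat.cone]
  rw [heq]
  refine IsClosed.inter (isClosed_iInter fun i => isClosed_le continuous_const (by fun_prop))
    (IsClosed.inter (isClosed_iInter fun j => isClosed_le (by fun_prop) (by fun_prop))
      (isClosed_iInter fun j => ?_))
  exact (isClosed_symPosSemidef (F.sdp j)).preimage
    (f := fun u : F.Space => u.2.2 j) (by fun_prop)

theorem sum_sq_le_one_of_mem_simplexBar {m : ℕ} {v : Fin m → ℝ} (hv : v ∈ simplexBar m) :
    ∑ i, v i ^ 2 ≤ 1 := by
  have h1 : ∑ i, v i ≤ 1 := by linarith [hv.2]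
  refine le_trans (Finset.sum_le_sum fun i _ => ?_) h1
  have h2 := Finset.single_le_sum (fun j _ => hv.1 j) (Finset.mem_univ i)
  have h3 := hv.1 i
  nlinarith

namespace Problem

variable {m d ℓ : ℕ} (P : Problem m d ℓ)

theorem continuous_fAt : Continuous P.fAt := by
  unfold fAt
  fun_prop

theorem continuous_aHatAt : Continuous P.aHatAt := by
  unfold aHatAt
  fun_prop

variable {P}

theorem isTruncPos_of_mem_relaxFeasible {k : ℕ} {h : d ≤ 2 * k}
    {q : (Fin ℓ → ℝ) × Tms m (2 * k)} (hq : q ∈ P.relaxFeasible k h) : IsTruncPos q.2 :=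
  .of_posSemidef hq.2.2.2.2.2 hq.2.1 hq.2.2.1 hq.2.2.2.1

/-- Every feasible point of the conic problem lifts to every relaxation of positive order, by the
moments of a representing atomic measure. -/
theorem exists_mem_relaxFeasible {k : ℕ} (hk : 0 < k) (h : d ≤ 2 * k) {w : Fin ℓ → ℝ}
    (hw : w ∈ P.feasible) : ∃ z, (w, z) ∈ P.relaxFeasible k h := by
  obtain ⟨⟨r, lam, v, hlam, hv, hsum⟩, hf⟩ := hw
  refine ⟨∑ i, lam i • monoVec (2 * k) (v i), ?_, fun i => ?_, ?_, ?_, hf, ?_⟩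
  · rw [hsum]
    funext α
    simp [trunc, monoVec, Finset.sum_apply]
  · refine posSemidef_localizingMatrix_sum ?_ hlam fun j => by simpa using (hv j).1 i
    rw [totalDegree_X]
    omega
  · refine posSemidef_localizingMatrix_sum ?_ hlam fun j => by simpa [sumX] using (hv j).2
    have := totalDegree_slack_le m
    omega
  · refine posSemidef_localizingMatrix_sum ?_ hlam fun j => by
      simpa using sum_sq_le_one_of_mem_simplexBar (hv j)
    have := totalDegree_ball_le m
    omega
  · exact posSemidef_localizingMatrix_sum (by simp) hlam fun j => by simp

theorem IsRelaxMinimizer.objective_le {k : ℕ} (hk : 0 < k) {h : d ≤ 2 * k} {w : Fin ℓ → ℝ}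
    {z : Tms m (2 * k)} (hmin : P.IsRelaxMinimizer k h w z) {w' : Fin ℓ → ℝ}
    (hw' : w' ∈ P.feasible) : P.c ⬝ᵥ w ≤ P.c ⬝ᵥ w' := by
  obtain ⟨z', hz'⟩ := exists_mem_relaxFeasible hk h hw'
  exact hmin.2 _ hz'

/-- Weak duality for a relaxation: the dual functional `⟨p̂, ·⟩` of the moment part is bounded by
the objective value. -/
theorem pairFunctional_le_objective {k : ℕ} {h : d ≤ 2 * k} {q : (Fin ℓ → ℝ) × Tms m (2 * k)}
    (hq : q ∈ P.relaxFeasible k h) {e : MvPolynomial (Fin m) ℝ × Module.Dual ℝ P.K.Space}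
    (he : e ∈ P.dualFeasible) :
    pairFunctional q.2 e.1 ≤ pair e.1 (P.aHat 0) + e.2 (P.f 0) + P.c ⬝ᵥ q.1 := by
  obtain ⟨hc, hp, hη⟩ := he
  have hf := hη _ hq.2.2.2.2.1
  have h1 : e.2 (P.fAt q.1) = e.2 (P.f 0) + ∑ i : Fin ℓ, q.1 i * e.2 (P.f i.succ) := by
    simp [fAt]
  have h2 : pairFunctional q.2 e.1
      = pair e.1 (P.aHat 0) + ∑ i : Fin ℓ, q.1 i * pair e.1 (P.aHat i.succ) := by
    rw [← pairFunctional_trunc h q.2 hp.1, ← hq.1, aHatAt]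
    change pairLinear d e.1 _ = _
    rw [map_add, map_sum]
    simp only [map_smul, smul_eq_mul]
    rfl
  have h3 : P.c ⬝ᵥ q.1 = ∑ i : Fin ℓ, q.1 i * pair e.1 (P.aHat i.succ)
      + ∑ i : Fin ℓ, q.1 i * e.2 (P.f i.succ) := by
    rw [dotProduct, ← Finset.sum_add_distrib]
    refine Finset.sum_congr rfl fun i _ => ?_
    rw [← hc i]
    ring
  linarith

/-- Linear independence of the `â_i` bounds `w` in terms of `â(w)`. -/
theorem exists_norm_le_of_norm_aHatAt_le (hlin : LinearIndependent ℝ P.aHat) (B : ℝ) :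
    ∃ C, ∀ w, ‖P.aHatAt w‖ ≤ B → ‖w‖ ≤ C := by
  have hli : LinearIndependent ℝ fun i : Fin ℓ => P.aHat i.succ :=
    hlin.comp _ (Fin.succ_injective ℓ)
  obtain ⟨K, -, hK⟩ := (Fintype.linearCombination ℝ fun i : Fin ℓ => P.aHat i.succ)
    |>.exists_antilipschitzWith
    (LinearMap.ker_eq_bot.2 hli.fintypeLinearCombination_injective)
  refine ⟨K * (B + ‖P.aHat 0‖), fun w hw => ?_⟩
  have h1 := hK.le_mul_norm_sub w 0
  simp only [map_zero, neg_add_eq_sub, zero_sub, norm_neg] at h1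
  refine h1.trans (mul_le_mul_of_nonneg_left ?_ K.2)
  have h2 : Fintype.linearCombination ℝ (fun i : Fin ℓ => P.aHat i.succ) w
      = P.aHatAt w - P.aHat 0 := by
    rw [Fintype.linearCombination_apply, aHatAt, add_sub_cancel_left]
  rw [h2]
  exact (norm_sub_le _ _).trans (by gcongr)

end Problem

end CPConic
end

theorem mainTheorem5 (m d ℓ : ℕ) (hd : 0 < d) (P : CPConic.Problem m d ℓ)
    (hlin : LinearIndependent ℝ P.aHat)
    (hprimal : P.feasible.Nonempty)
    (hdual : ∃ q ∈ P.dualFeasible,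
      ∀ x ∈ CPConic.simplexBar m, 0 < MvPolynomial.eval x q.1)
    (w : ℕ → Fin ℓ → ℝ) (z : (k : ℕ) → CPConic.Tms m (2 * k))
    (hmin : ∀ (k : ℕ) (hk : CPConic.initialOrder d ≤ k),
      P.IsRelaxMinimizer k (CPConic.le_two_mul_of_initialOrder_le hk) (w k) (z k)) :
    Bornology.IsBounded (w '' Set.Ici (CPConic.initialOrder d)) ∧
      ∀ wInf : Fin ℓ → ℝ, MapClusterPt wInf Filter.atTop w → P.IsMinimizer wInf := by
  obtain ⟨w₀, hw₀⟩ := hprimal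
  obtain ⟨q, hq, hqpos⟩ := hdual
  have hobj : ∀ k, CPConic.initialOrder d ≤ k → ∀ w' ∈ P.feasible, P.c ⬝ᵥ w k ≤ P.c ⬝ᵥ w' := by
    intro k hk w' hw'
    have h2k := CPConic.le_two_mul_of_initialOrder_le hk
    exact (hmin k hk).objective_le (by omega) hw'
  have hpos : ∀ᶠ k in Filter.atTop, CPConic.IsTruncPos (z k) := by
    filter_upwards [Filter.eventually_ge_atTop (CPConic.initialOrder d)] with k hk
    exact CPConic.Problem.isTruncPos_of_mem_relaxFeasible (hmin k hk).1
  obtain ⟨B, hB⟩ := CPConic.exists_mass_bound hpos hqpos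
    (C := CPConic.pair q.1 (P.aHat 0) + q.2 (P.f 0) + P.c ⬝ᵥ w₀) (by
      filter_upwards [Filter.eventually_ge_atTop (CPConic.initialOrder d)] with k hk
      have h1 := CPConic.Problem.pairFunctional_le_objective (hmin k hk).1 hq
      have h2 := hobj k hk w₀ hw₀
      simp only at h1
      linarith)
  constructor
  · obtain ⟨C, hC⟩ := CPConic.Problem.exists_norm_le_of_norm_aHatAt_le hlin B
    have hbound : ∀ᶠ k in Filter.atTop, ‖w k‖ ≤ C := by
      filter_upwards [hpos, hB, Filter.eventually_ge_atTop (CPConic.initialOrder d),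
        Filter.eventually_ge_atTop d] with k h1 h2 hk hdk
      have h0 : 0 ≤ B := by
        have := h1.one 1 (by simp)
        rw [one_pow] at this
        exact this.trans h2
      refine hC _ ((pi_norm_le_iff_of_nonneg h0).2 fun α => ?_)
      have h3 := h1.abs_monomial_le α.1 (α.2.trans hdk)
      rw [(hmin k hk).1.1, Real.norm_eq_abs]
      have h2k := CPConic.le_two_mul_of_initialOrder_le hk
      rw [CPConic.pairFunctional_monomial (z k) ⟨α.1, α.2.trans h2k⟩] at h3
      exact h3.trans h2
    obtain ⟨N, hN⟩ := Filter.eventually_atTop.1 hbound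
    -- The bound holds from index `N` on; the earlier terms are finitely many.
    refine (((Set.finite_Iio N).image w).isBounded.union
      (Metric.isBounded_closedBall (x := (0 : Fin ℓ → ℝ)) (r := C))).subset ?_
    rintro _ ⟨k, -, rfl⟩
    rcases lt_or_ge k N with h | h
    · exact Or.inl ⟨k, h, rfl⟩
    · exact Or.inr (mem_closedBall_zero_iff.2 (hN k h))
  · intro wInf hcl
    obtain ⟨U, hU, hw⟩ := mapClusterPt_iff_ultrafilter.1 hcl
    have hge : ∀ᶠ k in U, CPConic.initialOrder d ≤ k := hU (Filter.eventually_ge_atTop _)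
    obtain ⟨y, hy, hlim⟩ := CPConic.exists_limit hU (hU hpos) (hU hB)
    -- The constraint `â(w_k) = z_k|_d` passes to the limit along `U`.
    have htrunc : P.aHatAt wInf = CPConic.truncSeq d y := by
      refine tendsto_nhds_unique ((P.continuous_aHatAt.tendsto wInf).comp hw) ?_
      refine tendsto_pi_nhds.2 fun α => ?_
      have h1 := hlim (MvPolynomial.monomial α.1 1)
      rw [CPConic.rieszFunctional_monomial] at h1
      refine h1.congr' ?_
      filter_upwards [hge] with k hk
      have h2k := CPConic.le_two_mul_of_initialOrder_le hk
      rw [Function.comp_apply, (hmin k hk).1.1,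
        CPConic.pairFunctional_monomial (z k) ⟨α.1, α.2.trans h2k⟩]
      rfl
    refine ⟨⟨?_, ?_⟩, fun w' hw' => ?_⟩
    · rw [htrunc]
      exact CPConic.truncSeq_mem_momentCone d hy
    · refine P.K.isClosed_cone.mem_of_tendsto ((P.continuous_fAt.tendsto wInf).comp hw) ?_
      filter_upwards [hge] with k hk
      exact (hmin k hk).1.2.2.2.2.1
    · have hc : Continuous fun u : Fin ℓ → ℝ => P.c ⬝ᵥ u :=
        Continuous.dotProduct continuous_const continuous_id
      refine le_of_tendsto ((hc.tendsto wInf).comp hw) ?_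
      filter_upwards [hge] with k hk
      exact hobj k hk w' hw'
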